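/- Let $E/\mathbb{Q}$ be an elliptic curve of rank $0$, let $p$ be an odd prime, let $K/\mathbb{Q}$ be a quadratic field, and let $L/\mathbb{Q}$ be a dihedral Galois extension of degree $2p$ (that is, $\mathrm{Gal}(L/\mathbb{Q})$ is isomorphic to the dihedral group of order $2p$) that contains $K$. Assume that $E(L)[p]$ is trivial. Let $\overline{\mathbb{Q}}$ be an algebraic closure of $L$, and for $F\in\{\mathbb{Q},L\}$ let $H^1(F,E[p])=H^1(\mathrm{Gal}(\overline{\mathbb{Q}}/F),E(\overline{\mathbb{Q}})[p])$ be the first continuous Galois cohomology group (continuous crossed homomorphisms modulo principal ones, where $E(\overline{\mathbb{Q}})[p]$ is discrete). Let $\mathrm{res}: H^1(\mathbb{Q},E[p])\to H^1(L,E[p])$ be the restriction map, and let $\delta: E(L)/pE(L)\to H^1(L,E[p])$ be the Kummer map, which sends $[P]$ to the class of $\sigma\mapsto\sigma(Q)-Q$, where $Q\in E(\overline{\mathbb{Q}})$ is any point with $pQ=P$. Let $P\in E(L)$ be a point whose class $[P]\in E(L)/pE(L)$ is invariant under $\mathrm{Gal}(L/\mathbb{Q})$. Then there exists a unique class $c\in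 H^1(\mathbb{Q},E[p])$ such that $\mathrm{res}(c)=\delta([P])$. -/

import Mathlib

open Polynomial in
/-- `p` has degree at most `d`, and `c` is its coefficient of degree `d`. -/
def TopCoeff {K : Type*} [Field K] (p : K[X]) (d : ℕ) (c : K) : Prop :=
  p.natDegree ≤ d ∧ p.coeff d = c

namespace TopCoeff
open Polynomial
variable {K : Type*} [Field K] {p q : K[X]} {d e : ℕ} {a b : K}

theorem mul (hp : TopCoeff p d a) (hq : TopCoeff q e b) : TopCoeff (p * q) (d + e) (a * b) :=
  ⟨natDegree_mul_le_of_le hp.1 hq.1, by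
    rw [coeff_mul_add_eq_of_natDegree_le hp.1 hq.1, hp.2, hq.2]⟩

theorem add (hp : TopCoeff p d a) (hq : TopCoeff q d b) : TopCoeff (p + q) d (a + b) :=
  ⟨natDegree_add_le_of_degree_le hp.1 hq.1, by rw [coeff_add, hp.2, hq.2]⟩

theorem sub (hp : TopCoeff p d a) (hq : TopCoeff q d b) : TopCoeff (p - q) d (a - b) :=
  ⟨natDegree_sub_le_of_le hp.1 hq.1 |>.trans (by simp), by rw [coeff_sub, hp.2, hq.2]⟩

theorem const (c : K) : TopCoeff (C c) 0 c := ⟨by simp, by simp⟩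

theorem var : TopCoeff (X : K[X]) 1 1 := ⟨natDegree_X_le, by simp⟩

theorem lift (hp : TopCoeff p d a) : TopCoeff p (d + 1) 0 :=
  ⟨hp.1.trans (Nat.le_succ d), coeff_eq_zero_of_natDegree_lt (Nat.lt_succ_of_le hp.1)⟩

theorem cast (hp : TopCoeff p d a) (hd : d = e) (hab : a = b) : TopCoeff p e b := by
  subst hd; subst hab; exact hp

theorem ne_zero (hp : TopCoeff p d a) (ha : a ≠ 0) : p ≠ 0 := by
  rintro rfl
  exact ha (by rw [← hp.2, coeff_zero])

theorem natDegree_eq (hp : TopCoeff p d a) (ha : a ≠ 0) : p.natDegree = d :=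
  le_antisymm hp.1 (le_natDegree_of_ne_zero (by rw [hp.2]; exact ha))

end TopCoeff

namespace WeierstrassCurve.Affine.Point
open Polynomial
variable {K : Type*} [Field K] {W : WeierstrassCurve.Affine K}

theorem exists_equation [IsAlgClosed K] (W : WeierstrassCurve.Affine K) (x : K) :
    ∃ y, W.Equation x y := by
  obtain ⟨y, hy⟩ := IsAlgClosed.exists_root
    (X ^ 2 + (C (W.a₁ * x + W.a₃) * X + C (-(x ^ 3 + W.a₂ * x ^ 2 + W.a₄ * x + W.a₆))) : K[X]) (by
      have : (X ^ 2 + (C (W.a₁ * x + W.a₃) * X +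
        C (-(x ^ 3 + W.a₂ * x ^ 2 + W.a₄ * x + W.a₆))) : K[X]).degree = 2 := by
        compute_degree!
      rw [this]; decide)
  refine ⟨y, (W.equation_iff x y).2 ?_⟩
  simp only [IsRoot.def, eval_add, eval_mul, eval_pow, eval_X, eval_C] at hy
  linear_combination hy

theorem finite_setOf_xRep_mem {T : Set (Fin 2 → K)} (hT : T.Finite) :
    {P : W.Point | P.xRep ∈ T}.Finite := by
  refine hT.preimage' (f := fun P : W.Point ↦ P.xRep) fun b _ ↦ ?_
  rcases (((fun P : W.Point ↦ P.xRep) ⁻¹' {b}).eq_empty_or_nonempty) with h | ⟨P, hP⟩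
  · rw [h]; exact Set.finite_empty
  · refine (Set.toFinite {P, -P}).subset fun Q hQ ↦ ?_
    exact eq_or_eq_neg_of_xRep_eq_xRep (hQ.trans hP.symm)

variable [DecidableEq K]

/-- Multiplication by `n` acts on all but finitely many `x`-coordinates as a rational function
`A / B` with the leading behaviour `x / n ^ 2` at infinity. -/
def MulByRational (W : WeierstrassCurve.Affine K) (n : ℕ) : Prop :=
  ∃ (A B : K[X]) (d : ℕ) (a : K), a ≠ 0 ∧ TopCoeff A (d + 1) a ∧ TopCoeff B d ((n : K) ^ 2 * a) ∧
    ∃ S : Set K, S.Finite ∧ ∀ (x y : K) (h : W.Nonsingular x y), x ∉ S →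
      B.eval x ≠ 0 ∧ ∃ (y' : K) (h' : W.Nonsingular (A.eval x / B.eval x) y'),
        n • some x y h = some (A.eval x / B.eval x) y' h'

theorem mulByRational_one : MulByRational W 1 := by
  refine ⟨X, 1, 0, 1, one_ne_zero, TopCoeff.var, ?_, ∅, Set.finite_empty, ?_⟩
  · simpa using TopCoeff.const (1 : K)
  · intro x y h _
    refine ⟨by simp, y, by simpa using h, by simp⟩

theorem mulByRational_two [CharZero K] : MulByRational W 2 := by
  have t1 : TopCoeff (X ^ 2 : K[X]) 2 1 := by
    simpa [pow_two] using (TopCoeff.var (K := K)).mul (TopCoeff.var (K := K))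
  have t3 : TopCoeff (X ^ 3 : K[X]) 3 1 := by
    simpa [← pow_succ] using t1.mul (TopCoeff.var (K := K))
  have t4 : TopCoeff (X ^ 4 : K[X]) 4 1 := by simpa [← pow_add] using t1.mul t1
  have hB : TopCoeff (C 4 * X ^ 3 + C W.b₂ * X ^ 2 + C (2 * W.b₄) * X + C W.b₆ : K[X]) 3
      (((2 : ℕ) : K) ^ 2 * 1) := by
    refine ((((TopCoeff.const 4).mul t3).add ((TopCoeff.const W.b₂).mul t1).lift).add
      ((TopCoeff.const (2 * W.b₄)).mul TopCoeff.var).lift.lift).add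
      (TopCoeff.const W.b₆).lift.lift.lift |>.cast rfl ?_
    norm_num
  have hA : TopCoeff (X ^ 4 - C W.b₄ * X ^ 2 - C (2 * W.b₆) * X - C W.b₈ : K[X]) 4 1 := by
    refine ((t4.sub ((TopCoeff.const W.b₄).mul t1).lift.lift).sub
      ((TopCoeff.const (2 * W.b₆)).mul TopCoeff.var).lift.lift.lift).sub
      (TopCoeff.const W.b₈).lift.lift.lift.lift |>.cast rfl ?_
    norm_num
  refine ⟨_, _, 3, 1, one_ne_zero, hA, hB, _,
    finite_setOfPred_isRoot (hB.ne_zero (by norm_num)), ?_⟩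
  intro x y h hx
  simp only [Set.mem_ofPred_eq, IsRoot.def] at hx
  refine ⟨hx, ?_⟩
  have heq := (W.equation_iff x y).1 h.1
  have hsq : (y - W.negY x y) ^ 2 = 4 * x ^ 3 + W.b₂ * x ^ 2 + 2 * W.b₄ * x + W.b₆ := by
    simp only [negY, b₂, b₄, b₆]
    linear_combination 4 * heq
  have hev : (C 4 * X ^ 3 + C W.b₂ * X ^ 2 + C (2 * W.b₄) * X + C W.b₆ : K[X]).eval x =
      (y - W.negY x y) ^ 2 := by
    rw [hsq]; simp
  have hy : y - W.negY x y ≠ 0 := by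
    intro h0
    rw [hev, h0] at hx
    simp at hx
  have hy' : y ≠ W.negY x y := sub_ne_zero.1 hy
  have key : W.addX x x (W.slope x x y y) =
      (X ^ 4 - C W.b₄ * X ^ 2 - C (2 * W.b₆) * X - C W.b₈ : K[X]).eval x /
      (C 4 * X ^ 3 + C W.b₂ * X ^ 2 + C (2 * W.b₄) * X + C W.b₆ : K[X]).eval x := by
    rw [hev, slope_of_Y_ne rfl hy', addX]
    field_simp
    simp only [negY, b₄, b₆, b₈, eval_sub, eval_mul, eval_pow, eval_X, eval_C]
    linear_combination (- W.a₁ ^ 2 - 4 * W.a₂ - 8 * x) * heq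
  rw [← key]
  exact ⟨_, _, by rw [two_nsmul, add_self_of_Y_ne hy']⟩

/-- The sum of the `x`-coordinates of `P + Q` and `P - Q`. -/
theorem addX_add_addX_neg {x₁ y₁ x₂ y₂ : K} (h₁ : W.Equation x₁ y₁) (h₂ : W.Equation x₂ y₂)
    (hx : x₁ ≠ x₂) :
    W.addX x₁ x₂ (W.slope x₁ x₂ y₁ y₂) + W.addX x₁ x₂ (W.slope x₁ x₂ y₁ (W.negY x₂ y₂)) =
      (2 * (x₁ + x₂) * (x₁ * x₂) + W.b₂ * (x₁ * x₂) + W.b₄ * (x₁ + x₂) + W.b₆) /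
        (x₁ - x₂) ^ 2 := by
  have hx' : x₁ - x₂ ≠ 0 := sub_ne_zero.2 hx
  have e₁ := (W.equation_iff x₁ y₁).1 h₁
  have e₂ := (W.equation_iff x₂ y₂).1 h₂
  rw [slope_of_X_ne hx, slope_of_X_ne hx]
  simp only [addX, negY, b₂, b₄, b₆]
  field_simp
  linear_combination 2 * e₁ + 2 * e₂

theorem mulByRational_succ [CharZero K] {n : ℕ} (h1 : MulByRational W (n + 1))
    (h2 : MulByRational W (n + 2)) : MulByRational W (n + 3) := by
  obtain ⟨A₁, B₁, d₁, a₁, ha₁, hA₁, hB₁, S₁, hS₁, H₁⟩ := h1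
  obtain ⟨A₂, B₂, d₂, a₂, ha₂, hA₂, hB₂, S₂, hS₂, H₂⟩ := h2
  have c0 (k : ℕ) : ((n : K) + k + 1) ≠ 0 := by exact_mod_cast Nat.succ_ne_zero (n + k)
  have hXB : TopCoeff (X * B₂) (d₂ + 1) (((n + 2 : ℕ) : K) ^ 2 * a₂) :=
    (TopCoeff.var.mul hB₂).cast (by ring) (by ring)
  have hdiff := hA₂.sub hXB
  have hdiff0 : A₂ - X * B₂ ≠ 0 := by
    refine hdiff.ne_zero ?_
    have : a₂ - ((n + 2 : ℕ) : K) ^ 2 * a₂ = - (a₂ * (n + (0 : ℕ) + 1) * (n + (2 : ℕ) + 1)) := by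
      push_cast; ring
    rw [this]
    exact neg_ne_zero.2 (mul_ne_zero (mul_ne_zero ha₂ (c0 0)) (c0 2))
  have hsum := hA₂.add hXB
  have hAX := hA₂.mul (TopCoeff.var (K := K))
  have n1 := ((TopCoeff.const (2 : K)).mul hsum).mul hAX
  have n2 := (TopCoeff.const W.b₂).mul (hAX.mul hB₂)
  have n3 := (TopCoeff.const W.b₄).mul (hsum.mul hB₂)
  have n4 := (TopCoeff.const W.b₆).mul (hB₂.mul hB₂)
  have hN := ((n1.add (n2.lift.cast (e := 0 + (d₂ + 1) + (d₂ + 1 + 1)) (by ring) rfl)).add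
    (n3.lift.lift.cast (e := 0 + (d₂ + 1) + (d₂ + 1 + 1)) (by ring) rfl)).add
    (n4.lift.lift.lift.cast (e := 0 + (d₂ + 1) + (d₂ + 1 + 1)) (by ring) rfl)
  set N := C 2 * (A₂ + X * B₂) * (A₂ * X) + C W.b₂ * (A₂ * X * B₂) +
    C W.b₄ * ((A₂ + X * B₂) * B₂) + C W.b₆ * (B₂ * B₂) with hNdef
  have hD := hdiff.mul hdiff
  have hA := (hN.mul hB₁).sub ((hD.mul hA₁).cast
    (e := 0 + (d₂ + 1) + (d₂ + 1 + 1) + d₁) (by ring) rfl)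
  have hB := hD.mul hB₁
  refine ⟨_, _, d₂ + 1 + (d₂ + 1) + d₁, a₂ ^ 2 * a₁ * (n + (0 : ℕ) + 1) ^ 4, ?_,
    hA.cast (by ring) (by push_cast; ring), hB.cast rfl (by push_cast; ring),
    S₁ ∪ S₂ ∪ {x | (A₂ - X * B₂).IsRoot x}, (hS₁.union hS₂).union (finite_setOfPred_isRoot hdiff0), ?_⟩
  · exact mul_ne_zero (mul_ne_zero (pow_ne_zero _ ha₂) ha₁) (pow_ne_zero _ (c0 0))
  intro x y h hx
  simp only [Set.mem_union, not_or, Set.mem_ofPred_eq, IsRoot.def] at hx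
  obtain ⟨⟨hx1, hx2⟩, hx3⟩ := hx
  obtain ⟨hb₁, y₁, h₁, e₁⟩ := H₁ x y h hx1
  obtain ⟨hb₂, y₂, h₂, e₂⟩ := H₂ x y h hx2
  have hne : A₂.eval x / B₂.eval x ≠ x := by
    intro h0
    rw [div_eq_iff hb₂] at h0
    exact hx3 (by simp [h0])
  have hx3' : A₂.eval x - x * B₂.eval x ≠ 0 := by simpa using hx3
  have hBx : ((A₂ - X * B₂) * (A₂ - X * B₂) * B₁).eval x ≠ 0 := by
    simp only [eval_mul]
    exact mul_ne_zero (mul_ne_zero hx3 hx3) hb₁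
  have hsub : (n + 1) • some x y h = (n + 2) • some x y h + -some x y h := by
    rw [show n + 2 = n + 1 + 1 from rfl, succ_nsmul _ (n + 1)]; abel
  rw [e₁, e₂, neg_some, add_of_X_ne hne] at hsub
  have hsubx := (some.inj hsub).1
  have hform := addX_add_addX_neg h₂.1 h.1 hne
  rw [← hsubx] at hform
  have key : W.addX (A₂.eval x / B₂.eval x) x (W.slope (A₂.eval x / B₂.eval x) x y₂ y) =
      (N * B₁ - (A₂ - X * B₂) * (A₂ - X * B₂) * A₁).eval x /
        ((A₂ - X * B₂) * (A₂ - X * B₂) * B₁).eval x := by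
    rw [eq_sub_of_add_eq hform]
    have hq : A₂.eval x / B₂.eval x - x ≠ 0 := sub_ne_zero.2 hne
    have hq' : A₂.eval x / B₂.eval x - x = (A₂.eval x - x * B₂.eval x) / B₂.eval x := by
      field_simp
    rw [hq']
    simp only [hNdef, eval_mul, eval_sub, eval_add, eval_X, eval_C]
    set u := A₂.eval x - x * B₂.eval x with hu
    field_simp
  refine ⟨hBx, ?_⟩
  rw [← key]
  exact ⟨_, _, by rw [show n + 3 = n + 2 + 1 from rfl, succ_nsmul, e₂, add_of_X_ne hne]⟩

theorem mulByRational [CharZero K] (n : ℕ) : MulByRational W (n + 1) := by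
  suffices h : MulByRational W (n + 1) ∧ MulByRational W (n + 2) from h.1
  induction n with
  | zero => exact ⟨mulByRational_one, mulByRational_two⟩
  | succ n ih => exact ⟨ih.2, mulByRational_succ ih.1 ih.2⟩

/-- Points of an elliptic curve over an algebraically closed field of characteristic zero are
divisible by every positive integer. -/
theorem exists_nsmul_eq [CharZero K] [IsAlgClosed K] [W.IsElliptic] {n : ℕ} (hn : n ≠ 0)
    (P : W.Point) : ∃ Q : W.Point, n • Q = P := by
  obtain ⟨m, rfl⟩ := Nat.exists_eq_succ_of_ne_zero hn
  obtain ⟨A, B, d, a, ha, hA, hB, S, hS, H⟩ := mulByRational (W := W) m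
  have hB0 : B ≠ 0 := hB.ne_zero (mul_ne_zero (pow_ne_zero _ (by exact_mod_cast hn)) ha)
  obtain ⟨A', hA'⟩ := EuclideanDomain.gcd_dvd_left A B
  obtain ⟨B', hB'⟩ := EuclideanDomain.gcd_dvd_right A B
  set g := EuclideanDomain.gcd A B with hg
  have hg0 : g ≠ 0 := fun h ↦ hB0 (by rw [hB', h, zero_mul])
  have hcop : IsCoprime A' B' := by
    refine ⟨EuclideanDomain.gcdA A B, EuclideanDomain.gcdB A B, mul_left_cancel₀ hg0 ?_⟩
    have := EuclideanDomain.gcd_eq_gcd_ab A B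
    rw [← hg] at this
    linear_combination -this - EuclideanDomain.gcdA A B * hA' - EuclideanDomain.gcdB A B * hB'
  have hgdeg : g.natDegree ≤ d := (natDegree_le_of_dvd ⟨B', hB'⟩ hB0).trans hB.1
  let T : Set (Fin 2 → K) := (fun x ↦ ![A'.eval x / B'.eval x, 1]) '' S
  have hT : T.Finite := hS.image _
  have main (R : W.Point) (hR : R.xRep ∉ T) : ∃ Q : W.Point, (m + 1) • Q = R := by
    rcases R with _ | ⟨x₀, y₀, h₀⟩
    · exact ⟨0, nsmul_zero _⟩
    have hdeg : (A' - C x₀ * B').degree ≠ 0 := by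
      intro h
      have e : A - C x₀ * B = g * (A' - C x₀ * B') := by
        conv_lhs => rw [hA', hB']
        ring
      have t : TopCoeff (A - C x₀ * B) (d + 1) (a - 0) :=
        hA.sub (((TopCoeff.const x₀).mul hB).lift.cast (by ring) rfl)
      have t' := t.natDegree_eq (by simpa using ha)
      rw [e] at t'
      have := natDegree_mul_le (p := g) (q := A' - C x₀ * B')
      rw [natDegree_eq_of_degree_eq_some (n := 0) h] at this
      omega
    obtain ⟨x, hx⟩ := IsAlgClosed.exists_root _ hdeg
    simp only [IsRoot.def, eval_sub, eval_mul, eval_C] at hx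
    have hBx : B'.eval x ≠ 0 := by
      intro h
      obtain ⟨u, v, huv⟩ := hcop
      have := congrArg (eval x) huv
      rw [h, mul_zero, sub_zero] at hx
      simp [h, hx] at this
    have hx₀ : A'.eval x / B'.eval x = x₀ := by
      rw [div_eq_iff hBx]; linear_combination hx
    have hxS : x ∉ S := fun h ↦ hR ⟨x, h, by simp [hx₀]⟩
    obtain ⟨y, hy⟩ := exists_equation W x
    obtain ⟨hb, y', h', e⟩ := H x y (equation_iff_nonsingular.1 hy) hxS
    have hq : A.eval x / B.eval x = x₀ := by
      rw [← hx₀]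
      rw [hB', eval_mul] at hb
      conv_lhs => rw [hA', hB', eval_mul, eval_mul]
      rw [mul_div_mul_left _ _ (left_ne_zero_of_mul hb)]
    have hrep : ((m + 1) • some x y (equation_iff_nonsingular.1 hy)).xRep =
        (some x₀ y₀ h₀).xRep := by
      rw [e, xRep_some, xRep_some, hq]
    rcases eq_or_eq_neg_of_xRep_eq_xRep hrep with h | h
    · exact ⟨_, h⟩
    · exact ⟨-_, by rw [smul_neg, h, neg_neg]⟩
  have hinf : Infinite W.Point := by
    choose y hy using exists_equation W
    have : Infinite K := IsAlgClosed.instInfinite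
    refine Infinite.of_injective
      (fun x ↦ some x (y x) (equation_iff_nonsingular.1 (hy x))) fun x x' h ↦ (some.inj h).1
  have hfin := finite_setOf_xRep_mem (W := W) hT
  obtain ⟨R, hR⟩ := (hfin.union (hfin.preimage (f := fun R ↦ P - R)
    (sub_right_injective.injOn))).exists_notMem
  simp only [Set.mem_union, Set.mem_preimage, Set.mem_ofPred_eq, not_or] at hR
  obtain ⟨Q₁, h₁⟩ := main R hR.1
  obtain ⟨Q₂, h₂⟩ := main (P - R) hR.2
  exact ⟨Q₁ + Q₂, by rw [nsmul_add, h₁, h₂, add_sub_cancel]⟩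

end WeierstrassCurve.Affine.Point

/-! ### Continuous group cohomology in degree one with discrete coefficients -/

section ContinuousH1

variable (G : Type*) [Group G] [TopologicalSpace G] (M : Type*) [AddCommGroup M]
  [DistribMulAction G M]

/-- Continuous crossed homomorphisms `G → M`, where `M` carries the discrete topology
(so that continuous means locally constant). -/
def ContZ1 : AddSubgroup (G → M) where
  carrier := {f | IsLocallyConstant f ∧ ∀ g h : G, f (g * h) = f g + g • f h}
  zero_mem' := ⟨IsLocallyConstant.const 0, fun g h ↦ by simp⟩
  add_mem' := fun {a b} ha hb ↦ ⟨ha.1.add hb.1, fun g h ↦ by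
    simp only [Pi.add_apply, ha.2, hb.2, smul_add]; abel⟩
  neg_mem' := fun {a} ha ↦ ⟨ha.1.neg, fun g h ↦ by
    simp only [Pi.neg_apply, ha.2, smul_neg]; abel⟩

/-- The continuous crossed homomorphisms that are principal, i.e. of the form
`g ↦ g • m - m`. -/
def ContB1 : AddSubgroup (ContZ1 G M) where
  carrier := {f | ∃ m : M, ∀ g : G, f.1 g = g • m - m}
  zero_mem' := ⟨0, fun g ↦ by simp⟩
  add_mem' := by
    rintro a b ⟨m, hm⟩ ⟨m', hm'⟩
    exact ⟨m + m', fun g ↦ by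
      simp only [AddSubgroup.coe_add, Pi.add_apply, hm, hm', smul_add]; abel⟩
  neg_mem' := by
    rintro a ⟨m, hm⟩
    exact ⟨-m, fun g ↦ by
      simp only [AddSubgroup.coe_neg, Pi.neg_apply, hm, smul_neg]; abel⟩

/-- The first continuous cohomology group `H¹(G, M)` of a topological group `G` acting on a
discrete abelian group `M`. -/
abbrev ContH1 : Type _ := ContZ1 G M ⧸ ContB1 G M

variable {G M} {H : Type*} [Group H] [TopologicalSpace H] [DistribMulAction H M]

/-- Pulling back crossed homomorphisms along a continuous homomorphism `φ : H → G` that is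
compatible with the actions on `M`. -/
def ContZ1.pullback (φ : H →* G) (hφ : Continuous φ) (hM : ∀ (h : H) (m : M), φ h • m = h • m) :
    ContZ1 G M →+ ContZ1 H M where
  toFun f := ⟨fun h ↦ f.1 (φ h), f.2.1.comp_continuous hφ, fun g h ↦ by
    simp only [map_mul, f.2.2, hM]⟩
  map_zero' := rfl
  map_add' _ _ := rfl

/-- The map `H¹(G, M) → H¹(H, M)` induced by a continuous homomorphism `φ : H → G` that is
compatible with the actions on `M`. -/
def ContH1.pullback (φ : H →* G) (hφ : Continuous φ) (hM : ∀ (h : H) (m : M), φ h • m = h • m) :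
    ContH1 G M →+ ContH1 H M :=
  QuotientAddGroup.map _ _ (ContZ1.pullback φ hφ hM) (by
    rintro f ⟨m, hm⟩
    exact ⟨m, fun h ↦ (hm (φ h)).trans (by rw [hM])⟩)

end ContinuousH1

/-! ### The Galois module of points of an elliptic curve -/

/-- The action of `G` on `M` restricts to the `n`-torsion subgroup `M[n]`. -/
instance torsionByDistribMulAction {G M : Type*} [Monoid G] [AddCommGroup M]
    [DistribMulAction G M] (n : ℤ) : DistribMulAction G (AddSubgroup.torsionBy M n) where
  smul g x := ⟨g • x.1, by
    have hx : n • x.1 = 0 := (Submodule.mem_torsionBy_iff n x.1).1 x.2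
    refine (Submodule.mem_torsionBy_iff n (g • x.1)).2 ?_
    rw [← smul_comm g n x.1, hx, smul_zero]⟩
  one_smul x := Subtype.ext (one_smul G x.1)
  mul_smul g h x := Subtype.ext (mul_smul g h x.1)
  smul_zero g := Subtype.ext (smul_zero g)
  smul_add g x y := Subtype.ext (smul_add g x.1 y.1)

theorem torsionBy_coe_smul {G M : Type*} [Monoid G] [AddCommGroup M]
    [DistribMulAction G M] {n : ℤ} (g : G) (x : AddSubgroup.torsionBy M n) :
    ((g • x : AddSubgroup.torsionBy M n) : M) = g • (x : M) := rfl

namespace WeierstrassCurve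

variable {k : Type*} [Field k] (E : WeierstrassCurve k)

/-- The group `E(F)` of `F`-rational points of a curve `E` over `k`, for an extension `F / k`. -/
abbrev PointsOver (F : Type*) [Field F] [Algebra k F] : Type _ :=
  (E.baseChange F).toAffine.Point

variable (F Ω : Type*) [Field F] [Field Ω] [Algebra k F] [Algebra k Ω] [Algebra F Ω]
  [IsScalarTower k F Ω]

/-- `Gal(Ω / F)` acts on `E(Ω)` through the coordinates. -/
noncomputable instance galoisActionPoints [DecidableEq Ω] :
    DistribMulAction (Ω ≃ₐ[F] Ω) (E.PointsOver Ω) where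
  smul σ P := Affine.Point.map (W' := E.toAffine) (σ : Ω →ₐ[F] Ω) P
  one_smul P := by cases P <;> rfl
  mul_smul σ τ P := by cases P <;> rfl
  smul_zero σ := map_zero (Affine.Point.map (W' := E.toAffine) (σ : Ω →ₐ[F] Ω))
  smul_add σ := map_add (Affine.Point.map (W' := E.toAffine) (σ : Ω →ₐ[F] Ω))

variable {F Ω} in
theorem galoisAction_apply [DecidableEq Ω] (σ : Ω ≃ₐ[F] Ω) (P : E.PointsOver Ω) :
    σ • P = Affine.Point.map (W' := E.toAffine) (σ : Ω →ₐ[F] Ω) P := rfl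

/-- The inclusion `E(F) → E(Ω)` for a tower of fields `Ω / F / k`. -/
noncomputable def pointsInclusion [DecidableEq F] [DecidableEq Ω] :
    E.PointsOver F →+ E.PointsOver Ω :=
  Affine.Point.baseChange (W' := E.toAffine) F Ω

/-- The Galois module `E[n] = E(Ω)[n]`. -/
abbrev TorsionPoints [DecidableEq Ω] (n : ℕ) : AddSubgroup (E.PointsOver Ω) :=
  AddSubgroup.torsionBy (E.PointsOver Ω) (n : ℤ)

/-- The Galois cohomology group `H¹(F, E[n])` of `Gal(Ω / F)`, where `Ω` is an algebraic closure
of `F`. -/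
abbrev GaloisH1 [DecidableEq Ω] (n : ℕ) : Type _ :=
  ContH1 (Ω ≃ₐ[F] Ω) (E.TorsionPoints Ω n)

/-- The quotient group `E(F) / n E(F)`. -/
abbrev PointsMod [DecidableEq F] (n : ℕ) : Type _ :=
  E.PointsOver F ⧸ (nsmulAddMonoidHom (α := E.PointsOver F) n).range

/-! ### Restriction -/

open scoped Topology in
/-- The inclusion `Gal(Ω / L) → Gal(Ω / F)` is continuous. -/
theorem continuous_restrictScalarsHom (F L Ω : Type*) [Field F] [Field L] [Field Ω] [Algebra F L]
    [Algebra F Ω] [Algebra L Ω] [IsScalarTower F L Ω] :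
    Continuous (AlgEquiv.restrictScalarsHom F : (Ω ≃ₐ[L] Ω) →* (Ω ≃ₐ[F] Ω)) := by
  refine continuous_of_continuousAt_one _ fun s hs ↦ ?_
  rw [map_one, krullTopology_mem_nhds_one_iff] at hs
  obtain ⟨K, hK, hs⟩ := hs
  rw [Filter.mem_map, krullTopology_mem_nhds_one_iff]
  obtain ⟨t, ht⟩ := (IntermediateField.essFiniteType_iff (F := F) (E := Ω) (K := K)).1 inferInstance
  refine ⟨IntermediateField.adjoin L (t : Set Ω), ?_, fun σ hσ ↦ hs ?_⟩
  · refine IntermediateField.finiteDimensional_adjoin fun x hx ↦ ?_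
    have hxK : x ∈ K := by
      rw [← ht]; exact IntermediateField.subset_adjoin F _ hx
    have : _root_.IsIntegral F (⟨x, hxK⟩ : K) := Algebra.IsIntegral.isIntegral _
    have hx' : _root_.IsIntegral F x := this.map K.val
    exact hx'.tower_top
  · rintro ⟨x, hx⟩
    have hx' : x ∈ IntermediateField.adjoin F (t : Set Ω) := by rw [ht]; exact hx
    have hle : IntermediateField.adjoin F (t : Set Ω) ≤
        (IntermediateField.adjoin L (t : Set Ω)).restrictScalars F :=
      IntermediateField.adjoin_le_iff.2 (IntermediateField.subset_adjoin L _)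
    exact hσ ⟨x, hle hx'⟩

/-- The restriction map `res : H¹(F, E[n]) → H¹(L, E[n])` for a tower of fields `Ω / L / F`. -/
noncomputable def galoisRes (F L Ω : Type*) [Field F] [Field L] [Field Ω] [Algebra F L]
    [Algebra F Ω] [Algebra L Ω] [IsScalarTower F L Ω] [Algebra k F] [Algebra k L] [Algebra k Ω]
    [IsScalarTower k F Ω] [IsScalarTower k L Ω] [DecidableEq Ω] (n : ℕ) :
    E.GaloisH1 F Ω n →+ E.GaloisH1 L Ω n :=
  ContH1.pullback (AlgEquiv.restrictScalarsHom F) (continuous_restrictScalarsHom F L Ω)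
    (fun σ x ↦ Subtype.ext (by
      rcases x with ⟨_ | _, _⟩ <;> rfl))

/-! ### The Kummer map -/

section Kummer

variable [DecidableEq Ω]

variable {F Ω} in
theorem isLocallyConstant_smul [Algebra.IsAlgebraic F Ω] (Q : E.PointsOver Ω) :
    IsLocallyConstant fun σ : Ω ≃ₐ[F] Ω ↦ σ • Q := by
  have key (x : Ω) : IsLocallyConstant fun σ : Ω ≃ₐ[F] Ω ↦ σ x := by
    have ho : IsOpen (MulAction.stabilizer (Ω ≃ₐ[F] Ω) x : Set (Ω ≃ₐ[F] Ω)) :=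
      stabilizer_isOpen_of_isIntegral x
    refine (IsLocallyConstant.iff_exists_open _).2 fun σ ↦
      ⟨(fun τ ↦ σ⁻¹ * τ) ⁻¹' _, ho.preimage (continuous_const_mul σ⁻¹), ?_, fun τ hτ ↦ ?_⟩
    · simp
    · have h : (σ⁻¹ * τ) x = x := hτ
      have h' := congrArg σ h
      rwa [← AlgEquiv.mul_apply, mul_inv_cancel_left] at h'
  rcases Q with _ | ⟨x, y, h⟩
  · exact IsLocallyConstant.const (0 : E.PointsOver Ω)
  · refine (IsLocallyConstant.iff_eventually_eq _).2 fun σ ↦ ?_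
    filter_upwards [(IsLocallyConstant.iff_eventually_eq _).1 (key x) σ,
      (IsLocallyConstant.iff_eventually_eq _).1 (key y) σ] with τ hx hy
    exact (Affine.Point.some.injEq ..).mpr ⟨hx, hy⟩

variable [DecidableEq F]

variable {F Ω} in
theorem smul_pointsInclusion (σ : Ω ≃ₐ[F] Ω) (P : E.PointsOver F) :
    σ • E.pointsInclusion F Ω P = E.pointsInclusion F Ω P :=
  Affine.Point.map_baseChange (W' := E.toAffine) (σ : Ω →ₐ[F] Ω) P

variable {E F Ω} in
/-- The crossed homomorphism `σ ↦ σ Q - Q` with values in `E[n]`, for a point `Q ∈ E(Ω)` such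
that `n Q = P` is `F`-rational. -/
noncomputable def kummerCocycle [Algebra.IsAlgebraic F Ω] {n : ℕ} (P : E.PointsOver F)
    (Q : E.PointsOver Ω) (hQ : n • Q = E.pointsInclusion F Ω P) :
    ContZ1 (Ω ≃ₐ[F] Ω) (E.TorsionPoints Ω n) :=
  ⟨fun σ ↦ ⟨σ • Q - Q, AddSubgroup.torsionBy.nsmul_iff.2 (by
      rw [nsmul_sub, ← smul_comm σ n Q, hQ, smul_pointsInclusion, sub_self])⟩, by
    refine ⟨(IsLocallyConstant.iff_eventually_eq _).2 fun σ ↦ ?_, fun σ τ ↦ Subtype.ext ?_⟩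
    · filter_upwards [(IsLocallyConstant.iff_eventually_eq _).1 (E.isLocallyConstant_smul Q) σ]
        with τ hτ
      exact Subtype.ext (congrArg (· - Q) hτ)
    · simp only [AddSubgroup.coe_add, torsionBy_coe_smul, smul_sub, mul_smul]
      abel⟩

variable {E F Ω} in
/-- The class of `σ ↦ σ Q - Q` does not depend on the choice of `Q` with `n Q = P`, and it
is additive in `P`. -/
theorem kummerCocycle_add [Algebra.IsAlgebraic F Ω] {n : ℕ} {P P' P'' : E.PointsOver F}
    {Q Q' Q'' : E.PointsOver Ω} (hQ : n • Q = E.pointsInclusion F Ω P)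
    (hQ' : n • Q' = E.pointsInclusion F Ω P') (hQ'' : n • Q'' = E.pointsInclusion F Ω P'')
    (R : E.PointsOver F) (h : P'' = P + P' + n • R) :
    (QuotientAddGroup.mk (kummerCocycle P'' Q'' hQ'') : E.GaloisH1 F Ω n) =
      QuotientAddGroup.mk (kummerCocycle P Q hQ) + QuotientAddGroup.mk (kummerCocycle P' Q' hQ')
      := by
  rw [← QuotientAddGroup.mk_add, eq_comm, QuotientAddGroup.eq]
  refine ⟨⟨Q'' - Q - Q' - E.pointsInclusion F Ω R, AddSubgroup.torsionBy.nsmul_iff.2 ?_⟩,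
    fun σ ↦ Subtype.ext ?_⟩
  · rw [nsmul_sub, nsmul_sub, nsmul_sub, hQ, hQ', hQ'', h, map_add, map_add, map_nsmul]
    abel
  · simp only [kummerCocycle, AddSubgroup.coe_add, AddSubgroup.coe_neg, AddSubgroup.coe_sub,
      Pi.add_apply, Pi.neg_apply, torsionBy_coe_smul, smul_sub, smul_pointsInclusion]
    abel

variable [E.IsElliptic] [CharZero Ω] [IsAlgClosure F Ω]

variable {E F Ω} in
theorem exists_nsmul_eq_pointsInclusion {n : ℕ} (hn : n ≠ 0) (P : E.PointsOver F) :
    ∃ Q : E.PointsOver Ω, n • Q = E.pointsInclusion F Ω P :=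
  haveI : IsAlgClosed Ω := IsAlgClosure.isAlgClosed F
  haveI : (E.baseChange Ω).toAffine.IsElliptic :=
    inferInstanceAs (E.map (algebraMap k Ω)).IsElliptic
  Affine.Point.exists_nsmul_eq hn _

/-- The Kummer homomorphism `E(F) → H¹(F, E[n])`. It sends `P` to the class of the crossed
homomorphism `σ ↦ σ Q - Q`, where `Q ∈ E(Ω)` is any point with `n Q = P`. -/
noncomputable def kummerHom (n : ℕ) [NeZero n] : E.PointsOver F →+ E.GaloisH1 F Ω n :=
  haveI : Algebra.IsAlgebraic F Ω := IsAlgClosure.isAlgebraic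
  AddMonoidHom.mk' (fun P ↦ QuotientAddGroup.mk (kummerCocycle P
      (exists_nsmul_eq_pointsInclusion (Ω := Ω) (NeZero.ne n) P).choose
      (exists_nsmul_eq_pointsInclusion (Ω := Ω) (NeZero.ne n) P).choose_spec))
    fun P P' ↦ kummerCocycle_add _ _ _ 0 (by rw [nsmul_zero, add_zero])

variable {E F Ω} in
theorem kummerHom_apply [Algebra.IsAlgebraic F Ω] {n : ℕ} [NeZero n] (P : E.PointsOver F)
    (Q : E.PointsOver Ω) (hQ : n • Q = E.pointsInclusion F Ω P) :
    E.kummerHom F Ω n P = QuotientAddGroup.mk (kummerCocycle P Q hQ) := by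
  refine (kummerCocycle_add hQ (P' := 0) (Q' := 0) (by simp) _ 0 (by simp)).trans ?_
  rw [add_eq_left, QuotientAddGroup.eq_zero_iff]
  exact ⟨0, fun σ ↦ Subtype.ext (by simp [kummerCocycle])⟩

/-- The Kummer map `δ : E(F) / n E(F) → H¹(F, E[n])`. It sends the class of `P` to the class of
the crossed homomorphism `σ ↦ σ Q - Q`, where `Q ∈ E(Ω)` is any point with `n Q = P`. -/
noncomputable def kummerMap (n : ℕ) [NeZero n] : E.PointsMod F n →+ E.GaloisH1 F Ω n :=
  QuotientAddGroup.lift _ (E.kummerHom F Ω n) (by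
    have : Algebra.IsAlgebraic F Ω := IsAlgClosure.isAlgebraic
    rintro _ ⟨R, rfl⟩
    rw [AddMonoidHom.mem_ker, nsmulAddMonoidHom_apply, kummerHom_apply _ (E.pointsInclusion F Ω R) (map_nsmul _ n R).symm,
      QuotientAddGroup.eq_zero_iff]
    exact ⟨0, fun σ ↦ Subtype.ext (by simp [kummerCocycle, smul_pointsInclusion])⟩)

variable {E F Ω} in
theorem kummerMap_mk [Algebra.IsAlgebraic F Ω] {n : ℕ} [NeZero n] (P : E.PointsOver F)
    (Q : E.PointsOver Ω) (hQ : n • Q = E.pointsInclusion F Ω P) :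
    E.kummerMap F Ω n (QuotientAddGroup.mk P) = QuotientAddGroup.mk (kummerCocycle P Q hQ) :=
  kummerHom_apply P Q hQ

end Kummer

end WeierstrassCurve

/-!
The statement is an instance of the inflation-restriction principle. Put `G = Gal(Ω / ℚ)`,
`N = Gal(Ω / L)`, a normal subgroup of `G`, and `M = E[p]`. By Galois descent `M ^ N = E(L)[p]`,
and this is zero by assumption.

*Uniqueness* (`ContH1.pullback_injective`). Suppose that a crossed homomorphism `f : G → M` becomes
principal on `N`. Subtracting a principal one, `f` vanishes on `N`. As `N` is normal, every value
of `f` is then fixed by `N`, hence is zero.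

*Existence* (`WeierstrassCurve.exists_galoisRes_eq_kummerMap`). The obstruction to extending
an invariant class from `N` to `G` lives in `H²(G / N, M ^ N) = 0`, but for a Kummer class the
extension can be written down. Choose `Q ∈ E(Ω)` with `p Q = P`. As the class of `P` is invariant,
`σ P - P = p R_σ` for some `R_σ ∈ E(L)`, which is unique because `E(L)[p] = 0`. The uniqueness
makes `σ ↦ R_σ` a crossed homomorphism that vanishes on `N`, so `σ ↦ σ Q - Q - R_σ` is a crossed
homomorphism `G → E[p]` whose restriction to `N` is the Kummer cocycle of `P`.
-/

/-! ### Injectivity of restriction -/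

/-- If the image of `φ : H → G` is normal and `H` has no nonzero invariants in `M`, then
`H¹(G, M) → H¹(H, M)` is injective, its kernel being inflated from `M ^ H`. -/
theorem ContH1.pullback_injective {G H M : Type*} [Group G] [TopologicalSpace G] [Group H]
    [TopologicalSpace H] [AddCommGroup M] [DistribMulAction G M] [DistribMulAction H M]
    (φ : H →* G) (hφ : Continuous φ) (hM : ∀ (h : H) (m : M), φ h • m = h • m)
    [hN : φ.range.Normal] (hinv : ∀ m : M, (∀ h : H, h • m = m) → m = 0) :
    Function.Injective (ContH1.pullback (M := M) φ hφ hM) := by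
  refine (injective_iff_map_eq_zero _).2 fun c hc ↦ ?_
  obtain ⟨f, rfl⟩ := QuotientAddGroup.mk_surjective c
  obtain ⟨m, hm⟩ := (QuotientAddGroup.eq_zero_iff (ContZ1.pullback φ hφ hM f)).1 hc
  refine (QuotientAddGroup.eq_zero_iff f).2 ⟨m, fun g ↦ sub_eq_zero.1 (hinv _ fun h ↦ ?_)⟩
  obtain ⟨h', hh'⟩ : g⁻¹ * φ h * g ∈ φ.range := by
    simpa using hN.conj_mem _ ⟨h, rfl⟩ g⁻¹
  have hm' (h : H) : f.1 (φ h) = φ h • m - m := (hm h).trans (by rw [hM])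
  -- Compare the two expansions of `f (φ h * g) = f (g * φ h')`.
  have hcomm : φ h * g = g * φ h' := by rw [hh']; group
  have key : f.1 (φ h * g) = f.1 (g * φ h') := by rw [hcomm]
  have hact : φ h • g • m = g • φ h' • m := by rw [← mul_smul, hcomm, mul_smul]
  rw [f.2.2, f.2.2, hm', hm', smul_sub, ← hact] at key
  rw [← hM, smul_sub, smul_sub]
  rw [← sub_eq_zero] at key ⊢
  rw [← key]
  abel

namespace WeierstrassCurve

/-! ### Galois descent for points -/

section Descent

variable {k : Type*} [Field k] (E : WeierstrassCurve k) {F L Ω : Type*} [Field F] [Field L]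
  [Field Ω] [Algebra k F] [Algebra k L] [Algebra k Ω] [Algebra F L] [Algebra F Ω] [Algebra L Ω]
  [IsScalarTower k F L] [IsScalarTower k F Ω] [IsScalarTower k L Ω] [IsScalarTower F L Ω]
  [DecidableEq L] [DecidableEq Ω]

theorem pointsInclusion_injective : Function.Injective (E.pointsInclusion L Ω) :=
  Affine.Point.map_injective _

/-- A point of `E(Ω)` fixed by `Gal(Ω / L)` is `L`-rational. -/
theorem exists_pointsInclusion_eq_of_smul_eq [IsGalois L Ω] (Q : E.PointsOver Ω)
    (hQ : ∀ σ : Ω ≃ₐ[L] Ω, σ • Q = Q) : ∃ R : E.PointsOver L, E.pointsInclusion L Ω R = Q := by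
  rcases Q with _ | ⟨x, y, h⟩
  · exact ⟨0, map_zero _⟩
  have hxy (σ : Ω ≃ₐ[L] Ω) : σ x = x ∧ σ y = y := (Affine.Point.some.injEq ..).mp (hQ σ)
  obtain ⟨x, rfl⟩ := (InfiniteGalois.mem_range_algebraMap_iff_fixed x).2 fun σ ↦ (hxy σ).1
  obtain ⟨y, rfl⟩ := (InfiniteGalois.mem_range_algebraMap_iff_fixed y).2 fun σ ↦ (hxy σ).2
  exact ⟨.some x y ((Affine.baseChange_nonsingular (W := E.toAffine)
    (f := IsScalarTower.toAlgHom k L Ω) (algebraMap L Ω).injective x y).1 h), rfl⟩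

/-- The inclusion `E(L) → E(Ω)` is equivariant for `Gal(Ω / F) → Gal(L / F)`. -/
theorem smul_pointsInclusion_of_normal [Normal F L] (σ : Ω ≃ₐ[F] Ω) (P : E.PointsOver L) :
    σ • E.pointsInclusion L Ω P =
      E.pointsInclusion L Ω (AlgEquiv.restrictNormalHom L σ • P) := by
  rcases P with _ | ⟨x, y, h⟩
  · rfl
  · exact (Affine.Point.some.injEq ..).mpr
      ⟨(σ.restrictNormal_commutes L x).symm, (σ.restrictNormal_commutes L y).symm⟩

end Descent

/-! ### Descent of invariant Kummer classes -/

section Kummer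

variable {k : Type*} [Field k] (E : WeierstrassCurve k) {F L Ω : Type*} [Field F] [Field L]
  [Field Ω] [Algebra k F] [Algebra k L] [Algebra k Ω] [Algebra F L] [Algebra F Ω] [Algebra L Ω]
  [IsScalarTower k F Ω] [IsScalarTower k L Ω] [IsScalarTower F L Ω]
  [DecidableEq L] [DecidableEq Ω]

/-- Restriction to `L` loses nothing when `E(L)[n] = 0`, this being the group of
`Gal(Ω / L)`-invariants of `E[n]`. -/
theorem galoisRes_injective [Normal F L] [IsGalois L Ω] {n : ℕ}
    (htors : ∀ Q : E.PointsOver L, n • Q = 0 → Q = 0) :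
    Function.Injective (E.galoisRes F L Ω n) := by
  have : (AlgEquiv.restrictScalarsHom F : (Ω ≃ₐ[L] Ω) →* (Ω ≃ₐ[F] Ω)).range.Normal := by
    -- `Gal(Ω / L)` is the kernel of the restriction `Gal(Ω / F) → Gal(L / F)`.
    have : (AlgEquiv.restrictScalarsHom F : (Ω ≃ₐ[L] Ω) →* (Ω ≃ₐ[F] Ω)).range =
        (AlgEquiv.restrictNormalHom (F := F) (K₁ := Ω) L).ker := by
      ext σ
      constructor
      · rintro ⟨τ, rfl⟩
        refine AlgEquiv.ext fun x ↦ (algebraMap L Ω).injective ?_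
        exact (AlgEquiv.restrictNormal_commutes _ L x).trans (τ.commutes x)
      · intro hσ
        refine ⟨AlgEquiv.ofRingEquiv (f := σ.toRingEquiv) fun x ↦ ?_, AlgEquiv.ext fun _ ↦ rfl⟩
        refine (σ.restrictNormal_commutes L x).symm.trans (congrArg _ ?_)
        exact congrArg (fun g : L ≃ₐ[F] L ↦ g x) (MonoidHom.mem_ker.1 hσ)
    rw [this]
    infer_instance
  refine ContH1.pullback_injective _ _ _ fun m hm ↦ Subtype.ext ?_
  obtain ⟨R, hR⟩ := E.exists_pointsInclusion_eq_of_smul_eq (L := L) m.1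
    fun σ ↦ congrArg Subtype.val (hm σ)
  have hR0 : R = 0 := htors R (E.pointsInclusion_injective (Ω := Ω) (by
    rw [map_nsmul, hR, map_zero]
    exact AddSubgroup.torsionBy.nsmul_iff.1 m.2))
  rw [← hR, hR0, map_zero]
  rfl

/-- A `Gal(L / F)`-invariant class of `E(L) / n E(L)` has a Kummer class that is restricted from
`F`, provided that `E(L)[n] = 0`. -/
theorem exists_galoisRes_eq_kummerMap [E.IsElliptic] [IsScalarTower k F L] [CharZero Ω]
    [IsAlgClosure L Ω] [IsGalois F L] {n : ℕ} [NeZero n] (htors : ∀ Q : E.PointsOver L, n • Q = 0 → Q = 0)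
    (P : E.PointsOver L) (hP : ∀ g : L ≃ₐ[F] L,
      (QuotientAddGroup.mk (g • P) : E.PointsMod L n) = QuotientAddGroup.mk P) :
    ∃ c : E.GaloisH1 F Ω n,
      E.galoisRes F L Ω n c = E.kummerMap L Ω n (QuotientAddGroup.mk P) := by
  have : Algebra.IsAlgebraic L Ω := IsAlgClosure.isAlgebraic
  have : Algebra.IsAlgebraic F Ω := Algebra.IsAlgebraic.trans F L Ω
  obtain ⟨Q, hQ⟩ := exists_nsmul_eq_pointsInclusion (Ω := Ω) (NeZero.ne n) P
  -- `E(L)` has no `n`-torsion, phrased for its image in `E(Ω)`.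
  have hinj (R : E.PointsOver Ω) (hR : ∃ R', E.pointsInclusion L Ω R' = R) (h : n • R = 0) :
      R = 0 := by
    obtain ⟨R', rfl⟩ := hR
    rw [← map_nsmul] at h
    rw [htors R' (E.pointsInclusion_injective (h.trans (map_zero _).symm)), map_zero]
  -- The invariance of the class of `P`; `n • Q` stands for `P`.
  have hex (σ : Ω ≃ₐ[F] Ω) : ∃ R : E.PointsOver L,
      n • E.pointsInclusion L Ω R = σ • n • Q - n • Q := by
    obtain ⟨R, hR⟩ := QuotientAddGroup.eq.1 (hP (AlgEquiv.restrictNormalHom L σ)).symm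
    refine ⟨R, ?_⟩
    rw [hQ, E.smul_pointsInclusion_of_normal, ← map_nsmul, ← map_sub]
    exact congrArg _ (hR.trans (neg_add_eq_sub _ _))
  choose R hR using hex
  -- As `E(L)[n] = 0`, the point `R σ` depends only on `σ • Q` and is a crossed homomorphism in `σ`.
  have hloc {σ τ : Ω ≃ₐ[F] Ω} (h : τ • Q = σ • Q) :
      E.pointsInclusion L Ω (R τ) = E.pointsInclusion L Ω (R σ) := by
    refine sub_eq_zero.1 (hinj _ ⟨R τ - R σ, map_sub _ _ _⟩ ?_)
    rw [nsmul_sub, hR, hR, smul_comm τ, smul_comm σ, h, sub_self]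
  have hmul (σ τ : Ω ≃ₐ[F] Ω) : E.pointsInclusion L Ω (R (σ * τ)) =
      E.pointsInclusion L Ω (R σ) + σ • E.pointsInclusion L Ω (R τ) := by
    refine sub_eq_zero.1 (hinj _ ⟨R (σ * τ) - (R σ + AlgEquiv.restrictNormalHom L σ • R τ), ?_⟩ ?_)
    · rw [map_sub, map_add, E.smul_pointsInclusion_of_normal]
    · rw [nsmul_sub, nsmul_add, ← smul_comm σ, hR, hR, hR, mul_smul, smul_sub]
      abel
  have hres (σ : Ω ≃ₐ[L] Ω) : E.pointsInclusion L Ω (R (AlgEquiv.restrictScalarsHom F σ)) = 0 := by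
    refine hinj _ ⟨_, rfl⟩ ?_
    rw [hR, hQ, sub_eq_zero]
    exact E.smul_pointsInclusion σ P
  let f : ContZ1 (Ω ≃ₐ[F] Ω) (E.TorsionPoints Ω n) :=
    ⟨fun σ ↦ ⟨σ • Q - Q - E.pointsInclusion L Ω (R σ), AddSubgroup.torsionBy.nsmul_iff.2 (by
      rw [nsmul_sub, hR, nsmul_sub, smul_comm σ, sub_self])⟩, by
      refine ⟨(IsLocallyConstant.iff_eventually_eq _).2 fun σ ↦ ?_, fun σ τ ↦ Subtype.ext ?_⟩
      · filter_upwards [(IsLocallyConstant.iff_eventually_eq _).1 (E.isLocallyConstant_smul Q) σ]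
          with τ hτ
        refine Subtype.ext ?_
        dsimp only
        rw [hτ, hloc hτ]
      · simp only [AddSubgroup.coe_add, torsionBy_coe_smul, smul_sub, mul_smul, hmul]
        abel⟩
  refine ⟨QuotientAddGroup.mk f, ?_⟩
  rw [kummerMap_mk P Q hQ]
  refine congrArg QuotientAddGroup.mk (Subtype.ext (funext fun σ ↦ Subtype.ext ?_))
  exact (congrArg _ (hres σ)).trans (sub_zero _)

end Kummer

end WeierstrassCurve

theorem mainTheorem7 (E : WeierstrassCurve ℚ) [E.IsElliptic]
    (hE : Module.rank ℤ (E.PointsOver ℚ) = 0)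
    (p : ℕ) [Fact p.Prime] (hp : p ≠ 2)
    (L : Type*) [Field L] [NumberField L] [IsGalois ℚ L] [DecidableEq L]
    (hL : Nonempty ((L ≃ₐ[ℚ] L) ≃* DihedralGroup p))
    (K : IntermediateField ℚ L) (hK : Module.finrank ℚ K = 2)
    (Ω : Type*) [Field Ω] [CharZero Ω] [DecidableEq Ω] [Algebra L Ω] [IsAlgClosure L Ω]
    (htors : ∀ Q : E.PointsOver L, p • Q = 0 → Q = 0)
    (P : E.PointsOver L)
    (hP : ∀ g : L ≃ₐ[ℚ] L,
      (QuotientAddGroup.mk (g • P) : E.PointsMod L p) = QuotientAddGroup.mk P) :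
    ∃! c : E.GaloisH1 ℚ Ω p,
      E.galoisRes ℚ L Ω p c = E.kummerMap L Ω p (QuotientAddGroup.mk P) := by
  have : IsAlgClosed Ω := IsAlgClosure.isAlgClosed L
  have : IsGalois L Ω := IsAlgClosure.isGalois L Ω
  obtain ⟨c, hc⟩ := E.exists_galoisRes_eq_kummerMap (F := ℚ) (Ω := Ω) htors P hP
  exact ⟨c, hc, fun c' hc' ↦ E.galoisRes_injective htors (hc'.trans hc.symm)⟩
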